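/- Let $n,m,d\ge 0$ be integers, let $N=\{0,1\}^n$, $M=\{0,1\}^m$, $D=\{0,1\}^d$, and let $\mathrm{Ext}=\{f_s\}_{s\in D}$ be a family of functions $f_s:N\to M$. Let $F_s:\mathbb{C}^N\to\mathbb{C}^M$ be the linear map with $(F_sP)(y)=\sum_{x:f_s(x)=y}P(x)$, let $\upsilon_M$ be the uniform distribution on $M$, and put $$\Delta[\mathrm{Ext}](P)=\frac1{|D|}\sum_{s\in D}F_s(P)-\Big(\sum_{x\in N}P(x)\Big)\upsilon_M .$$ For a positive integer $Q$, regard $x\in\mathrm{Mat}_Q(\mathbb{C}^N)$ as the block-diagonal matrix $\sum_{k\in N}x_k\otimes|k\rangle\langle k|\in\mathrm{Mat}_Q\otimes\mathrm{Mat}_N=\mathrm{Mat}_{QN}$. Write $\|\cdot\|_\infty,\|\cdot\|_1,\|\cdot\|_2$ for the operator norm, the trace norm and the Hilbert–Schmidt norm of matrices. For $K>0$ the operator space $\cap\cdot\cap\{K\ell_\infty,\ell_1\}$ on $\mathbb{C}^N$ is given by the norms $$\|x\|_{M_Q(\cap\cdot\cap\{K\ell_\infty,\ell_1\})}=\inf\Big\{\max\{\sqrt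 K\|a\|_\infty,\|\Gamma(a)\|_\infty\}\cdot\max\{\sqrt K\|b\|_\infty,\|\Gamma(b)\|_\infty\}:\ x=ab^*,\ a,b\in\mathrm{Mat}_{QN}\Big\},$$ where $\Gamma$ is the linear map with $\Gamma(|i\rangle\langle j|\otimes|k\rangle\langle l|)=|i\rangle\langle j|\otimes\langle k|\otimes\langle l|$. The operator space $\ell_1$ on $\mathbb{C}^M$ is given by $$\|y\|_{M_Q(\ell_1)}=\sup\{\|(A\otimes 1_M)\,y\,(B\otimes 1_M)\|_1:\ A,B\in\mathrm{Mat}_Q,\ \|A\|_2\le1,\ \|B\|_2\le 1\}.$$ The completely bounded norm of a linear map $u:E\to F$ is $\|u:E\to F\|_{\mathrm{cb}}=\sup_Q\sup\{\|(u(x_{ij}))_{ij}\|_{M_Q(F)}:\|x\|_{M_Q(E)}\le1\}$. A classical-quantum state $\rho_{QN}=\sum_{k\in N}\rho_k\otimes|k\rangle\langle k|$ is a positive semidefinite matrix of this form with trace one; $\rho_Q=\sum_k\rho_k$, and its conditional min-entropy is $$H_{\min}(N|Q)_\rho=-\log_2\min_\sigma\big\|(\sigma^{-1/2}\otimes1_N)\rho_{QN}(\sigma^{-1/2}\otimes1_N)\big\|_\infty,$$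 the minimum being over the density matrices $\sigma\in\mathrm{Mat}_Q$ whose support contains the support of $\rho_Q$, with generalized inverses. $\mathrm{Ext}$ is a quantum-proof $(k,\varepsilon)$-extractor if for every finite dimension $Q$ and every classical-quantum state $\rho_{QN}$ with $H_{\min}(N|Q)_\rho\ge k$, $$\Big\|\frac1{|D|}\sum_{s\in D}(\mathrm{id}_Q\otimes F_s)(\rho_{QN})-\rho_Q\otimes\upsilon_M\Big\|_1\le\varepsilon .$$ Then for all real $k$ and all $\varepsilon\ge0$: 1. if $\big\|\Delta[\mathrm{Ext}]:\cap\cdot\cap\{2^k\ell_\infty,\ell_1\}\to\ell_1\big\|_{\mathrm{cb}}\le\varepsilon$, then $\mathrm{Ext}$ is a quantum-proof $(k,2\varepsilon)$-extractor; 2. if $k\le n$ and $\mathrm{Ext}$ is a quantum-proof $(k-1,\varepsilon)$-extractor, then $\big\|\Delta[\mathrm{Ext}]:\cap\cdot\cap\{2^k\ell_\infty,\ell_1\}\to\ell_1\big\|_{\mathrm{cb}}\le8\varepsilon$. -/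

import Mathlib

open scoped ENNReal Kronecker

noncomputable section

namespace QuantumExtractor

/-! ### Norms of complex matrices -/

section Matrices

variable {m n : Type*} [Fintype m] [Fintype n] [DecidableEq m] [DecidableEq n]

open scoped Matrix.Norms.L2Operator in
/-- The operator norm (largest singular value) of a rectangular complex matrix. -/
def opNorm (A : Matrix m n ℂ) : ℝ := ‖A‖

open scoped MatrixOrder in
/-- The trace norm `Tr √(A* A)`. -/
def traceNorm (A : Matrix n n ℂ) : ℝ := (CFC.abs A).trace.re

/-- The Hilbert-Schmidt norm `√(Tr (A* A))`. -/
def hsNorm (A : Matrix n n ℂ) : ℝ := √((A.conjTranspose * A).trace.re)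

open scoped ComplexOrder in
/-- Density matrices: positive semidefinite matrices of trace one. -/
def IsState (σ : Matrix n n ℂ) : Prop := σ.PosSemidef ∧ σ.trace = 1

/-- `σ ^ (-1/2)` with the generalized inverse: the eigenvalue `t` is replaced by `1 / √t` if `t > 0`
and by `0` if `t = 0`. -/
def invSqrt (σ : Matrix n n ℂ) : Matrix n n ℂ := cfc (fun t : ℝ => (√t)⁻¹) σ

end Matrices

/-! ### Operator space structures and completely bounded norms -/

section OperatorSpaces

/-- A matrix norm structure on `E`: for every `q`, a size function on the `q × q` matrices with
entries in `E`. Values in `[0, ∞]` are used so that suprema and infima need no side conditions. -/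
abbrev MatrixNorms (E : Type*) := (q : ℕ) → Matrix (Fin q) (Fin q) E → ℝ≥0∞

/-- The completely bounded norm
`sup_q sup {‖(u (x i j))_{i j}‖_{M_q(F)} : ‖x‖_{M_q(E)} ≤ 1}`. -/
def cbNorm {E F : Type*} [AddCommGroup E] [Module ℂ E] [AddCommGroup F] [Module ℂ F]
    (normE : MatrixNorms E) (normF : MatrixNorms F) (u : E →ₗ[ℂ] F) : ℝ≥0∞ :=
  ⨆ (q : ℕ) (x : Matrix (Fin q) (Fin q) E) (_ : normE q x ≤ 1), normF q (x.map u)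

variable {q : ℕ} {N : Type*} [Fintype N] [DecidableEq N]

/-- The embedding of `Mat_q(ℂ^N)` into `Mat_{qN}` as block-diagonal matrices,
`x ↦ ∑ k, x_k ⊗ |k⟩⟨k|`. -/
def embed (x : Matrix (Fin q) (Fin q) (N → ℂ)) : Matrix (Fin q × N) (Fin q × N) ℂ :=
  Matrix.blockDiagonal fun k => x.map fun v => v k

/-- The reshuffling `Γ (|i⟩⟨j| ⊗ |k⟩⟨l|) = |i⟩⟨j| ⊗ ⟨k| ⊗ ⟨l|`, from `Mat_{qN}` to matrices with
row index `i` and column index `(j, k, l)`. -/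
def Gam (a : Matrix (Fin q × N) (Fin q × N) ℂ) : Matrix (Fin q) (Fin q × N × N) ℂ :=
  Matrix.of fun i c => a (i, c.2.1) (c.1, c.2.2)

/-- `max {√K ‖a‖, ‖Γ a‖}`, with operator norms. -/
def factorNorm (K : ℝ) (a : Matrix (Fin q × N) (Fin q × N) ℂ) : ℝ :=
  max (√K * opNorm a) (opNorm (Gam a))

/-- The operator space `∩·∩{K ℓ_∞, ℓ_1}` on `ℂ^N`: the norm of `x ∈ Mat_q(ℂ^N)` is the infimum of
`max {√K ‖a‖, ‖Γ a‖} * max {√K ‖b‖, ‖Γ b‖}` over all factorizations `x = a b*` in `Mat_{qN}`. -/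
def capCap (N : Type*) [Fintype N] [DecidableEq N] (K : ℝ) : MatrixNorms (N → ℂ) := fun q x =>
  ⨅ (a : Matrix (Fin q × N) (Fin q × N) ℂ) (b : Matrix (Fin q × N) (Fin q × N) ℂ)
    (_ : embed x = a * b.conjTranspose), ENNReal.ofReal (factorNorm K a * factorNorm K b)

/-- The operator space `ℓ_1` on `ℂ^N` (the diagonal of the trace class operator space): the norm of
`x ∈ Mat_q(ℂ^N)` is the supremum of the trace norms of `(A ⊗ 1) x (B ⊗ 1)` over `A, B ∈ Mat_q` of
Hilbert-Schmidt norm at most one. -/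
def ellOne (N : Type*) [Fintype N] [DecidableEq N] : MatrixNorms (N → ℂ) := fun q x =>
  ⨆ (A : Matrix (Fin q) (Fin q) ℂ) (B : Matrix (Fin q) (Fin q) ℂ)
    (_ : hsNorm A ≤ 1) (_ : hsNorm B ≤ 1),
    ENNReal.ofReal (traceNorm
      ((A ⊗ₖ (1 : Matrix N N ℂ)) * embed x * (B ⊗ₖ (1 : Matrix N N ℂ))))

end OperatorSpaces

/-! ### Classical-quantum states and conditional min-entropy -/

section States

variable {q : ℕ} {N : Type*} [Fintype N] [DecidableEq N]

/-- The partial trace over the classical system. -/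
def marginal (ρ : Matrix (Fin q) (Fin q) (N → ℂ)) : Matrix (Fin q) (Fin q) ℂ :=
  ρ.map fun v => ∑ k, v k

/-- `ρ = ∑ k, ρ_k ⊗ |k⟩⟨k|` is a classical-quantum density matrix. -/
def IsCQState (ρ : Matrix (Fin q) (Fin q) (N → ℂ)) : Prop := IsState (embed ρ)

/-- The conditional min-entropy
`H_min(N|Q) = - log₂ min_σ ‖(σ^{-1/2} ⊗ 1) ρ (σ^{-1/2} ⊗ 1)‖`, where `σ` runs over the states on `Q`
whose support contains that of `ρ_Q` (equivalently, whose kernel is contained in that of `ρ_Q`). -/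
def condMinEntropy (ρ : Matrix (Fin q) (Fin q) (N → ℂ)) : ℝ :=
  - Real.logb 2 (sInf {t : ℝ | ∃ σ : Matrix (Fin q) (Fin q) ℂ, IsState σ ∧
      (∀ v : Fin q → ℂ, σ.mulVec v = 0 → (marginal ρ).mulVec v = 0) ∧
      t = opNorm ((invSqrt σ ⊗ₖ (1 : Matrix N N ℂ)) * embed ρ *
        (invSqrt σ ⊗ₖ (1 : Matrix N N ℂ)))})

end States

/-! ### Extractors -/

section Extractors

variable {N M D : Type*} [Fintype N] [Fintype M] [Fintype D] [DecidableEq N] [DecidableEq M]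

/-- The linear map `F` on `ℂ^N` given by the `M × N` matrix with entry `1` at `(y, x)` if
`f x = y`, and `0` otherwise. -/
def pushMap (f : N → M) : (N → ℂ) →ₗ[ℂ] (M → ℂ) :=
  Matrix.toLin' (Matrix.of fun y x => if f x = y then 1 else 0)

/-- The uniform distribution. -/
def uniform (M : Type*) [Fintype M] : M → ℂ := fun _ => (Fintype.card M : ℂ)⁻¹

/-- `Δ[Ext] P = (1 / D) ∑ s, F_s P - (∑ x, P x) υ_M`. -/
def Delta (f : D → N → M) : (N → ℂ) →ₗ[ℂ] (M → ℂ) :=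
  (Fintype.card D : ℂ)⁻¹ • ∑ s, pushMap (f s) -
    (∑ x : N, LinearMap.proj x : (N → ℂ) →ₗ[ℂ] ℂ).smulRight (uniform M)

/-- The family `f` is a quantum-proof `(k, ε)`-extractor: for every finite-dimensional `Q` and every
classical-quantum state with `H_min(N|Q) ≥ k`,
`‖(1 / D) ∑ s, (id_Q ⊗ F_s) ρ - ρ_Q ⊗ υ_M‖₁ ≤ ε`. -/
def IsQuantumProof (k ε : ℝ) (f : D → N → M) : Prop :=
  ∀ (q : ℕ) (ρ : Matrix (Fin q) (Fin q) (N → ℂ)), IsCQState ρ → k ≤ condMinEntropy ρ →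
    traceNorm (embed ((Fintype.card D : ℂ)⁻¹ • ∑ s, ρ.map (pushMap (f s)) -
      (marginal ρ).map fun c => c • uniform M)) ≤ ε

end Extractors

end QuantumExtractor

end

/-
Up to limits, `H_min(N|Q) ≥ k` says that `ρ ≤ 2^{-k} σ ⊗ 1` for some state `σ` on `Q`.

Part 1. For such `ρ` and `σ`, put `τ = σ + ρ_Q`. Conjugating `ρ` by `τ^{-1/2} ⊗ 1` gives a positive
`x ≤ 2^{-k}` with marginal at most `1`, and its square root provides a factorization showing that
`x` lies in the unit ball of `∩·∩{2^k ℓ_∞, ℓ_1}`. Undoing the conjugation costs the factor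
`‖τ^{1/2}‖₂² = Tr τ = 2`.

Part 2. If `x = a b*` is a nearly optimal factorization, then `(A ⊗ 1) x (B ⊗ 1) = α β*` with
`α = (A ⊗ 1) a` and `β = (B* ⊗ 1) b`, and the bounds on `a` say that `α α* ≤ 2^{-k} A A* ⊗ 1` and
`Tr α α* ≤ 1`, similarly for `β`. Polarization writes `α β*` as a combination of the four positive
matrices `(α + z β)(α + z β)*` with `z⁴ = 1`. Each of them is, up to a factor `4`, subnormalized and
at most `2^{-k} σ ⊗ 1`; since `k ≤ n`, adding a multiple of `σ ⊗ υ_N` turns it into a state below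
`2^{-(k-1)} σ ⊗ 1`. These matrices need not be block diagonal, but discarding their off-diagonal
blocks keeps both properties and does not change the image under `id ⊗ u`.
-/

noncomputable section

namespace QuantumExtractor

open scoped MatrixOrder ComplexOrder Matrix

local notation "𝟙[" N "]" => (1 : Matrix N N ℂ)

section Loewner

variable {m n : Type*} [Fintype n]

theorem nonneg_mul_conjTranspose [Finite m] (A : Matrix m n ℂ) : 0 ≤ A * Aᴴ :=
  Matrix.nonneg_iff_posSemidef.2 (Matrix.posSemidef_self_mul_conjTranspose A)

theorem nonneg_conjTranspose_mul (A : Matrix n n ℂ) : 0 ≤ Aᴴ * A :=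
  Matrix.nonneg_iff_posSemidef.2 (Matrix.posSemidef_conjTranspose_mul_self A)

theorem mul_mul_conjTranspose_mono [Finite m] {A B : Matrix n n ℂ} (h : A ≤ B) (C : Matrix m n ℂ) :
    C * A * Cᴴ ≤ C * B * Cᴴ := by
  rw [Matrix.le_iff] at h ⊢
  simpa only [Matrix.mul_sub, Matrix.sub_mul] using h.mul_mul_conjTranspose_same C

theorem re_trace_mono {A B : Matrix n n ℂ} (h : A ≤ B) : A.trace.re ≤ B.trace.re := by
  have h0 : 0 ≤ (B - A).trace := (Matrix.le_iff.1 h).trace_nonneg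
  rw [Matrix.trace_sub, sub_nonneg] at h0
  exact Complex.re_le_re h0

theorem re_trace_nonneg {A : Matrix n n ℂ} (hA : 0 ≤ A) : 0 ≤ A.trace.re := by
  simpa only [Matrix.trace_zero, Complex.zero_re] using re_trace_mono hA

theorem ofReal_re_trace {A : Matrix n n ℂ} (hA : 0 ≤ A) : (A.trace.re : ℂ) = A.trace :=
  (Complex.eq_re_of_ofReal_le (Matrix.nonneg_iff_posSemidef.1 hA).trace_nonneg).symm

theorem mulVec_eq_zero_of_le {A B : Matrix n n ℂ} (hA : 0 ≤ A) (hAB : A ≤ B) {v : n → ℂ}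
    (hv : B *ᵥ v = 0) : A *ᵥ v = 0 := by
  have hA' := Matrix.nonneg_iff_posSemidef.1 hA
  have h := (Matrix.le_iff.1 hAB).dotProduct_mulVec_nonneg v
  rw [Matrix.sub_mulVec, hv, zero_sub, dotProduct_neg, neg_nonneg] at h
  exact (hA'.dotProduct_mulVec_zero_iff v).1 (h.antisymm (hA'.dotProduct_mulVec_nonneg v))

theorem mul_eq_zero_of_ker_le {A B C : Matrix n n ℂ}
    (h : ∀ v : n → ℂ, B *ᵥ v = 0 → A *ᵥ v = 0) (hBC : B * C = 0) : A * C = 0 := by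
  ext i j
  exact congrFun (h (fun l => C l j) (funext fun k => congrFun₂ hBC k j)) i

end Loewner

section FunctionalCalculus

variable {n : Type*} [Fintype n] [DecidableEq n]

theorem cfc_mul_cfc (f g : ℝ → ℝ) (A : Matrix n n ℂ) :
    cfc f A * cfc g A = cfc (fun t => f t * g t) A :=
  (cfc_mul f g A (A.finite_real_spectrum.continuousOn _)
    (A.finite_real_spectrum.continuousOn _)).symm

theorem conjTranspose_cfc (f : ℝ → ℝ) (A : Matrix n n ℂ) : (cfc f A)ᴴ = cfc f A :=
  (cfc_predicate f A : IsSelfAdjoint (cfc f A)).star_eq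

theorem conjTranspose_invSqrt (σ : Matrix n n ℂ) : (invSqrt σ)ᴴ = invSqrt σ :=
  conjTranspose_cfc _ σ

theorem conjTranspose_sqrt (σ : Matrix n n ℂ) : (CFC.sqrt σ)ᴴ = CFC.sqrt σ :=
  (CFC.sqrt_nonneg σ).isSelfAdjoint.star_eq

/-- The orthogonal projection onto the support of a positive semidefinite matrix. -/
def supportProj (σ : Matrix n n ℂ) : Matrix n n ℂ := cfc (fun t : ℝ => if 0 < t then 1 else 0) σ

theorem conjTranspose_supportProj (σ : Matrix n n ℂ) : (supportProj σ)ᴴ = supportProj σ :=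
  conjTranspose_cfc _ σ

theorem supportProj_le_one (σ : Matrix n n ℂ) : supportProj σ ≤ 1 := by
  refine cfc_le_one _ σ fun t _ => ?_
  split_ifs
  exacts [le_rfl, zero_le_one]

variable {σ : Matrix n n ℂ}

theorem sqrt_eq_cfc (hσ : 0 ≤ σ) : CFC.sqrt σ = cfc Real.sqrt σ := by
  rw [CFC.sqrt_eq_real_sqrt σ, cfcₙ_eq_cfc]

theorem sqrt_mul_invSqrt (hσ : 0 ≤ σ) : CFC.sqrt σ * invSqrt σ = supportProj σ := by
  rw [sqrt_eq_cfc hσ, invSqrt, cfc_mul_cfc]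
  refine cfc_congr fun t _ => ?_
  split_ifs with h
  · exact mul_inv_cancel₀ (Real.sqrt_pos.2 h).ne'
  · simp [Real.sqrt_eq_zero'.2 (not_lt.1 h)]

theorem invSqrt_mul_sqrt (hσ : 0 ≤ σ) : invSqrt σ * CFC.sqrt σ = supportProj σ := by
  rw [← conjTranspose_supportProj, ← sqrt_mul_invSqrt hσ, Matrix.conjTranspose_mul,
    conjTranspose_invSqrt, conjTranspose_sqrt]

theorem sqrt_mul_supportProj (hσ : 0 ≤ σ) : CFC.sqrt σ * supportProj σ = CFC.sqrt σ := by
  rw [sqrt_eq_cfc hσ, supportProj, cfc_mul_cfc]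
  refine cfc_congr fun t _ => ?_
  split_ifs with h
  · exact mul_one _
  · simp [Real.sqrt_eq_zero'.2 (not_lt.1 h)]

theorem mul_supportProj (hσ : 0 ≤ σ) : σ * supportProj σ = σ :=
  calc σ * supportProj σ = CFC.sqrt σ * (CFC.sqrt σ * supportProj σ) := by
        rw [← mul_assoc, CFC.sqrt_mul_sqrt_self σ]
    _ = σ := by rw [sqrt_mul_supportProj hσ, CFC.sqrt_mul_sqrt_self σ]

theorem invSqrt_mul_self (hσ : 0 ≤ σ) : invSqrt σ * σ = CFC.sqrt σ :=
  calc invSqrt σ * σ = invSqrt σ * CFC.sqrt σ * CFC.sqrt σ := by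
        rw [mul_assoc, CFC.sqrt_mul_sqrt_self σ]
    _ = (CFC.sqrt σ * supportProj σ)ᴴ := by
        rw [invSqrt_mul_sqrt hσ, Matrix.conjTranspose_mul, conjTranspose_supportProj,
          conjTranspose_sqrt]
    _ = CFC.sqrt σ := by rw [sqrt_mul_supportProj hσ, conjTranspose_sqrt]

theorem invSqrt_mul_mul_invSqrt (hσ : 0 ≤ σ) : invSqrt σ * σ * invSqrt σ = supportProj σ := by
  rw [invSqrt_mul_self hσ, sqrt_mul_invSqrt hσ]

end FunctionalCalculus

section OpNorm

open scoped Matrix.Norms.L2Operator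

variable {m n : Type*} [Fintype m] [Fintype n] [DecidableEq n]

theorem opNorm_nonneg (A : Matrix m n ℂ) : 0 ≤ opNorm A :=
  norm_nonneg A

theorem opNorm_eq_zero {A : Matrix m n ℂ} : opNorm A = 0 ↔ A = 0 :=
  norm_eq_zero

theorem opNorm_smul (c : ℝ) (A : Matrix m n ℂ) : opNorm (c • A) = |c| * opNorm A :=
  norm_smul c A

theorem opNorm_mul_le (A B : Matrix n n ℂ) : opNorm (A * B) ≤ opNorm A * opNorm B :=
  norm_mul_le A B

variable [DecidableEq m]

theorem opNorm_conjTranspose (A : Matrix m n ℂ) : opNorm Aᴴ = opNorm A :=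
  Matrix.l2_opNorm_conjTranspose A

theorem opNorm_mul_conjTranspose_self (A : Matrix m n ℂ) : opNorm (A * Aᴴ) = opNorm A ^ 2 := by
  have h := Matrix.l2_opNorm_conjTranspose_mul_self Aᴴ
  rwa [Matrix.conjTranspose_conjTranspose, Matrix.l2_opNorm_conjTranspose, ← sq] at h

theorem opNorm_le_iff {H : Matrix n n ℂ} (hH : 0 ≤ H) {r : ℝ} (hr : 0 ≤ r) :
    opNorm H ≤ r ↔ H ≤ r • (1 : Matrix n n ℂ) := by
  rw [← Algebra.algebraMap_eq_smul_one]
  exact CStarAlgebra.norm_le_iff_le_algebraMap H hr hH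

theorem opNorm_le_iff_mul_conjTranspose_le {A : Matrix m n ℂ} {r : ℝ} (hr : 0 ≤ r) :
    opNorm A ≤ r ↔ A * Aᴴ ≤ r ^ 2 • (1 : Matrix m m ℂ) := by
  rw [← opNorm_le_iff (nonneg_mul_conjTranspose A) (sq_nonneg r), opNorm_mul_conjTranspose_self,
    sq_le_sq₀ (opNorm_nonneg A) hr]

theorem opNorm_le_one_iff_mul_conjTranspose_le {A : Matrix m n ℂ} :
    opNorm A ≤ 1 ↔ A * Aᴴ ≤ 1 := by
  rw [opNorm_le_iff_mul_conjTranspose_le zero_le_one, one_pow, one_smul]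

end OpNorm

section TraceNorm

variable {n : Type*} [Fintype n] [DecidableEq n]

/-- The adjoint of the partial isometry in the polar decomposition of `A`, that is
`(A* A)^{-1/2} A*` with the generalized inverse. -/
def polarFactor (A : Matrix n n ℂ) : Matrix n n ℂ := invSqrt (Aᴴ * A) * Aᴴ

theorem polarFactor_mul_self (A : Matrix n n ℂ) : polarFactor A * A = CFC.abs A := by
  rw [polarFactor, mul_assoc, invSqrt_mul_self (nonneg_conjTranspose_mul A)]
  rfl

theorem opNorm_polarFactor_le_one (A : Matrix n n ℂ) : opNorm (polarFactor A) ≤ 1 := by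
  rw [opNorm_le_one_iff_mul_conjTranspose_le]
  calc polarFactor A * (polarFactor A)ᴴ
      = invSqrt (Aᴴ * A) * (Aᴴ * A) * invSqrt (Aᴴ * A) := by
        simp only [polarFactor, Matrix.conjTranspose_mul, Matrix.conjTranspose_conjTranspose,
          conjTranspose_invSqrt, mul_assoc]
    _ = supportProj (Aᴴ * A) := invSqrt_mul_mul_invSqrt (nonneg_conjTranspose_mul A)
    _ ≤ 1 := supportProj_le_one _

theorem mul_supportProj_conjTranspose_mul_self (A : Matrix n n ℂ) :
    A * supportProj (Aᴴ * A) = A := by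
  have h : Aᴴ * A * (1 - supportProj (Aᴴ * A)) = 0 := by
    rw [mul_sub, mul_supportProj (nonneg_conjTranspose_mul A), mul_one, sub_self]
  rw [Matrix.conjTranspose_mul_self_mul_eq_zero, mul_sub, mul_one, sub_eq_zero] at h
  exact h.symm

theorem conjTranspose_polarFactor_mul_abs (A : Matrix n n ℂ) :
    (polarFactor A)ᴴ * CFC.abs A = A :=
  calc (polarFactor A)ᴴ * CFC.abs A = A * (invSqrt (Aᴴ * A) * CFC.sqrt (Aᴴ * A)) := by
        rw [polarFactor, Matrix.conjTranspose_mul, Matrix.conjTranspose_conjTranspose,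
          conjTranspose_invSqrt, mul_assoc]
        rfl
    _ = A := by
        rw [invSqrt_mul_sqrt (nonneg_conjTranspose_mul A), mul_supportProj_conjTranspose_mul_self]

theorem re_trace_conj_le {C H : Matrix n n ℂ} (hC : opNorm C ≤ 1) (hH : 0 ≤ H) :
    (C * H * Cᴴ).trace.re ≤ H.trace.re := by
  set S := CFC.sqrt H with hS
  have hSS : S * S = H := CFC.sqrt_mul_sqrt_self H
  rw [← opNorm_conjTranspose, opNorm_le_one_iff_mul_conjTranspose_le,
    Matrix.conjTranspose_conjTranspose] at hC
  calc (C * H * Cᴴ).trace.re = (S * (Cᴴ * C) * Sᴴ).trace.re := by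
        rw [Matrix.trace_mul_comm, ← mul_assoc, ← hSS, ← mul_assoc, Matrix.trace_mul_comm,
          ← mul_assoc, hS, conjTranspose_sqrt]
    _ ≤ (S * 1 * Sᴴ).trace.re := re_trace_mono (mul_mul_conjTranspose_mono hC S)
    _ = H.trace.re := by rw [mul_one, hS, conjTranspose_sqrt, ← hS, hSS]

-- Expand `0 ≤ Tr (1 - C) H (1 - C)*`.
theorem re_trace_mul_le {C H : Matrix n n ℂ} (hC : opNorm C ≤ 1) (hH : 0 ≤ H) :
    (C * H).trace.re ≤ H.trace.re := by
  have hexpand : ((1 - C) * H * (1 - C)ᴴ).trace.re =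
      H.trace.re - (C * H).trace.re - (H * Cᴴ).trace.re + (C * H * Cᴴ).trace.re := by
    rw [Matrix.conjTranspose_sub, Matrix.conjTranspose_one,
      show (1 - C) * H * (1 - Cᴴ) = H - C * H - H * Cᴴ + C * H * Cᴴ by noncomm_ring]
    simp only [Matrix.trace_add, Matrix.trace_sub, Complex.add_re, Complex.sub_re]
  have hnonneg : 0 ≤ ((1 - C) * H * (1 - C)ᴴ).trace.re :=
    re_trace_nonneg (star_right_conjugate_nonneg hH (1 - C))
  have hadj : (H * Cᴴ).trace.re = (C * H).trace.re := by
    rw [show H * Cᴴ = (C * H)ᴴ by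
      rw [Matrix.conjTranspose_mul, ← Matrix.star_eq_conjTranspose H, hH.isSelfAdjoint.star_eq],
      Matrix.trace_conjTranspose, Complex.star_def, Complex.conj_re]
  linarith [re_trace_conj_le hC hH]

theorem re_trace_mul_le_traceNorm {C : Matrix n n ℂ} (hC : opNorm C ≤ 1) (A : Matrix n n ℂ) :
    (C * A).trace.re ≤ traceNorm A :=
  calc (C * A).trace.re = (C * (polarFactor A)ᴴ * CFC.abs A).trace.re := by
        rw [mul_assoc, conjTranspose_polarFactor_mul_abs]
    _ ≤ traceNorm A := by
        refine re_trace_mul_le ((opNorm_mul_le _ _).trans (mul_le_one₀ hC (opNorm_nonneg _) ?_))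
          (CFC.abs_nonneg A)
        rw [opNorm_conjTranspose]
        exact opNorm_polarFactor_le_one A

theorem traceNorm_nonneg (A : Matrix n n ℂ) : 0 ≤ traceNorm A :=
  re_trace_nonneg (CFC.abs_nonneg A)

theorem traceNorm_add_le (A B : Matrix n n ℂ) :
    traceNorm (A + B) ≤ traceNorm A + traceNorm B := by
  set W := polarFactor (A + B)
  have hW : opNorm W ≤ 1 := opNorm_polarFactor_le_one _
  calc traceNorm (A + B) = (W * A).trace.re + (W * B).trace.re := by
        rw [traceNorm, ← polarFactor_mul_self, mul_add, Matrix.trace_add, Complex.add_re]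
    _ ≤ traceNorm A + traceNorm B :=
        add_le_add (re_trace_mul_le_traceNorm hW A) (re_trace_mul_le_traceNorm hW B)

theorem traceNorm_zero : traceNorm (0 : Matrix n n ℂ) = 0 := by
  rw [traceNorm, CFC.abs_zero, Matrix.trace_zero, Complex.zero_re]

theorem traceNorm_sum_le {ι : Type*} (s : Finset ι) (A : ι → Matrix n n ℂ) :
    traceNorm (∑ i ∈ s, A i) ≤ ∑ i ∈ s, traceNorm (A i) :=
  Finset.le_sum_of_subadditive traceNorm traceNorm_zero.le traceNorm_add_le s A

theorem traceNorm_smul (c : ℂ) (A : Matrix n n ℂ) : traceNorm (c • A) = ‖c‖ * traceNorm A := by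
  rw [traceNorm, CFC.abs_smul, Matrix.trace_smul, Complex.real_smul, Complex.re_ofReal_mul,
    traceNorm]

end TraceNorm

section HilbertSchmidt

variable {n : Type*} [Fintype n]

theorem hsNorm_nonneg (A : Matrix n n ℂ) : 0 ≤ hsNorm A :=
  Real.sqrt_nonneg _

theorem hsNorm_sq (A : Matrix n n ℂ) : hsNorm A ^ 2 = (Aᴴ * A).trace.re :=
  Real.sq_sqrt (re_trace_nonneg (nonneg_conjTranspose_mul A))

theorem hsNorm_eq_zero {A : Matrix n n ℂ} : hsNorm A = 0 ↔ A = 0 := by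
  rw [← sq_eq_zero_iff, hsNorm_sq, ← Complex.ofReal_eq_zero,
    ofReal_re_trace (nonneg_conjTranspose_mul A), Matrix.trace_conjTranspose_mul_self_eq_zero_iff]

theorem hsNorm_smul (c : ℂ) (A : Matrix n n ℂ) : hsNorm (c • A) = ‖c‖ * hsNorm A := by
  rw [hsNorm, Matrix.conjTranspose_smul, smul_mul_smul_comm, Matrix.trace_smul, hsNorm,
    ← Real.sqrt_sq (norm_nonneg c), ← Real.sqrt_mul (sq_nonneg _), Complex.star_def,
    Complex.conj_mul', smul_eq_mul, ← Complex.ofReal_pow, Complex.re_ofReal_mul]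

theorem exists_hsNorm_le_one_smul_eq (A : Matrix n n ℂ) :
    ∃ A' : Matrix n n ℂ, hsNorm A' ≤ 1 ∧ (hsNorm A : ℂ) • A' = A := by
  refine ⟨((hsNorm A)⁻¹ : ℂ) • A, ?_, ?_⟩
  · rw [hsNorm_smul, norm_inv, Complex.norm_of_nonneg (hsNorm_nonneg A)]
    exact inv_mul_le_one
  · rcases eq_or_ne (hsNorm A) 0 with h | h
    · rw [hsNorm_eq_zero.1 h, smul_zero, smul_zero]
    · exact smul_inv_smul₀ (Complex.ofReal_ne_zero.2 h) A

end HilbertSchmidt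

section Kronecker

variable {m N : Type*} [DecidableEq N]

theorem sub_kronecker_one (A B : Matrix m m ℂ) : (A - B) ⊗ₖ 𝟙[N] = A ⊗ₖ 𝟙[N] - B ⊗ₖ 𝟙[N] := by
  simp only [Matrix.kronecker_one, ← Matrix.blockDiagonal_sub]
  rfl

theorem conjTranspose_kronecker_one (A : Matrix m m ℂ) : (A ⊗ₖ 𝟙[N])ᴴ = Aᴴ ⊗ₖ 𝟙[N] := by
  rw [Matrix.conjTranspose_kronecker, Matrix.conjTranspose_one]

theorem kronecker_one_mul [Fintype m] [Fintype N] (A B : Matrix m m ℂ) :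
    (A * B) ⊗ₖ 𝟙[N] = (A ⊗ₖ 𝟙[N]) * (B ⊗ₖ 𝟙[N]) := by
  rw [← Matrix.mul_kronecker_mul, one_mul]

variable [Finite m] [Finite N]

theorem kronecker_one_mono {A B : Matrix m m ℂ} (h : A ≤ B) : A ⊗ₖ 𝟙[N] ≤ B ⊗ₖ 𝟙[N] := by
  have h' : 0 ≤ (B - A) ⊗ₖ 𝟙[N] :=
    Matrix.nonneg_iff_posSemidef.2 ((Matrix.le_iff.1 h).kronecker Matrix.PosSemidef.one)
  rwa [sub_kronecker_one, sub_nonneg] at h'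

theorem kronecker_one_nonneg {A : Matrix m m ℂ} (hA : 0 ≤ A) : 0 ≤ A ⊗ₖ 𝟙[N] := by
  simpa only [Matrix.zero_kronecker] using kronecker_one_mono (N := N) hA

end Kronecker

section PartialTrace

variable {m N : Type*} [Fintype N]

/-- The partial trace over the second tensor factor. -/
def partialTrace (Y : Matrix (m × N) (m × N) ℂ) : Matrix m m ℂ := ∑ k, Matrix.blockDiag Y k

theorem partialTrace_apply (Y : Matrix (m × N) (m × N) ℂ) (i j : m) :
    partialTrace Y i j = ∑ k, Y (i, k) (j, k) := by
  simp only [partialTrace, Matrix.sum_apply, Matrix.blockDiag_apply]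

theorem partialTrace_sub (Y Z : Matrix (m × N) (m × N) ℂ) :
    partialTrace (Y - Z) = partialTrace Y - partialTrace Z := by
  simp only [partialTrace, Matrix.blockDiag_sub, Pi.sub_apply, Finset.sum_sub_distrib]

theorem partialTrace_nonneg {Y : Matrix (m × N) (m × N) ℂ} (hY : 0 ≤ Y) : 0 ≤ partialTrace Y :=
  Finset.sum_nonneg fun _ _ => Matrix.nonneg_iff_posSemidef.2
    ((Matrix.nonneg_iff_posSemidef.1 hY).submatrix _)

theorem partialTrace_mono {Y Z : Matrix (m × N) (m × N) ℂ} (h : Y ≤ Z) :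
    partialTrace Y ≤ partialTrace Z := by
  rw [← sub_nonneg, ← partialTrace_sub]
  exact partialTrace_nonneg (sub_nonneg.2 h)

theorem trace_partialTrace [Fintype m] (Y : Matrix (m × N) (m × N) ℂ) :
    (partialTrace Y).trace = Y.trace := by
  simp only [Matrix.trace, Matrix.diag_apply, partialTrace_apply, Fintype.sum_prod_type]

variable [DecidableEq N]

theorem partialTrace_kronecker_one (C : Matrix m m ℂ) :
    partialTrace (C ⊗ₖ 𝟙[N]) = (Fintype.card N : ℂ) • C := by
  ext i j
  simp [partialTrace_apply]

variable [Fintype m]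

theorem blockDiag_kronecker_one_mul_mul (A B : Matrix m m ℂ) (Y : Matrix (m × N) (m × N) ℂ)
    (k : N) :
    Matrix.blockDiag ((A ⊗ₖ 𝟙[N]) * Y * (B ⊗ₖ 𝟙[N])) k = A * Matrix.blockDiag Y k * B := by
  ext i j
  simp [Matrix.blockDiag_apply, Matrix.mul_apply, Fintype.sum_prod_type, Matrix.one_apply]

theorem partialTrace_kronecker_one_mul_mul (A B : Matrix m m ℂ) (Y : Matrix (m × N) (m × N) ℂ) :
    partialTrace ((A ⊗ₖ 𝟙[N]) * Y * (B ⊗ₖ 𝟙[N])) = A * partialTrace Y * B := by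
  simp only [partialTrace, blockDiag_kronecker_one_mul_mul, Finset.mul_sum, Finset.sum_mul]

variable {Y : Matrix (m × N) (m × N) ℂ} {σ : Matrix m m ℂ}

theorem partialTrace_ker_of_le (hY : 0 ≤ Y) {t : ℝ} (h : Y ≤ t • (σ ⊗ₖ 𝟙[N])) {v : m → ℂ}
    (hv : σ *ᵥ v = 0) : partialTrace Y *ᵥ v = 0 := by
  have h' := partialTrace_mono h
  refine mulVec_eq_zero_of_le (partialTrace_nonneg hY) h' ?_
  rw [← Matrix.smul_kronecker, partialTrace_kronecker_one, Matrix.smul_mulVec, Matrix.smul_mulVec,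
    hv, smul_zero, smul_zero]

theorem mul_kronecker_one_eq_zero (hY : 0 ≤ Y) {E : Matrix m m ℂ}
    (hE : partialTrace Y * E = 0) : Y * (E ⊗ₖ 𝟙[N]) = 0 := by
  classical
  set T := CFC.sqrt Y
  have hTT : T * T = Y := CFC.sqrt_mul_sqrt_self Y
  have htrace : ((T * (E ⊗ₖ 𝟙[N]))ᴴ * (T * (E ⊗ₖ 𝟙[N]))).trace = 0 := by
    rw [Matrix.conjTranspose_mul, conjTranspose_sqrt, mul_assoc, ← mul_assoc T, hTT, ← mul_assoc,
      conjTranspose_kronecker_one, ← trace_partialTrace, partialTrace_kronecker_one_mul_mul,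
      mul_assoc, hE, mul_zero, Matrix.trace_zero]
  rw [← hTT, mul_assoc, Matrix.trace_conjTranspose_mul_self_eq_zero_iff.1 htrace, mul_zero]

variable [DecidableEq m]

theorem mul_supportProj_kronecker_one (hY : 0 ≤ Y) (hσ : 0 ≤ σ)
    (hker : ∀ v : m → ℂ, σ *ᵥ v = 0 → partialTrace Y *ᵥ v = 0) :
    Y * (supportProj σ ⊗ₖ 𝟙[N]) = Y := by
  have h : Y * ((1 - supportProj σ) ⊗ₖ 𝟙[N]) = 0 := by
    refine mul_kronecker_one_eq_zero hY (mul_eq_zero_of_ker_le hker ?_)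
    rw [mul_sub, mul_one, mul_supportProj hσ, sub_self]
  rwa [sub_kronecker_one, Matrix.one_kronecker_one, mul_sub, mul_one, sub_eq_zero, eq_comm] at h

theorem sqrt_conj_invSqrt_conj (hY : 0 ≤ Y) (hσ : 0 ≤ σ)
    (hker : ∀ v : m → ℂ, σ *ᵥ v = 0 → partialTrace Y *ᵥ v = 0) :
    (CFC.sqrt σ ⊗ₖ 𝟙[N]) * ((invSqrt σ ⊗ₖ 𝟙[N]) * Y * (invSqrt σ ⊗ₖ 𝟙[N])) * (CFC.sqrt σ ⊗ₖ 𝟙[N]) =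
      Y := by
  have hright := mul_supportProj_kronecker_one hY hσ hker
  have hleft : (supportProj σ ⊗ₖ 𝟙[N]) * Y = Y := by
    have h := congrArg Matrix.conjTranspose hright
    rwa [Matrix.conjTranspose_mul, conjTranspose_kronecker_one, conjTranspose_supportProj,
      ← Matrix.star_eq_conjTranspose Y, hY.isSelfAdjoint.star_eq] at h
  calc _ = ((CFC.sqrt σ * invSqrt σ) ⊗ₖ 𝟙[N]) * Y * ((invSqrt σ * CFC.sqrt σ) ⊗ₖ 𝟙[N]) := by
        simp only [kronecker_one_mul, mul_assoc]
    _ = Y := by rw [sqrt_mul_invSqrt hσ, invSqrt_mul_sqrt hσ, hleft, hright]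

theorem invSqrt_conj_le (hσ : 0 ≤ σ) {t : ℝ} (ht : 0 ≤ t) (h : Y ≤ t • (σ ⊗ₖ 𝟙[N])) :
    (invSqrt σ ⊗ₖ 𝟙[N]) * Y * (invSqrt σ ⊗ₖ 𝟙[N]) ≤ t • (1 : Matrix (m × N) (m × N) ℂ) := by
  have hX : (invSqrt σ ⊗ₖ 𝟙[N])ᴴ = invSqrt σ ⊗ₖ 𝟙[N] := by
    rw [conjTranspose_kronecker_one, conjTranspose_invSqrt]
  calc (invSqrt σ ⊗ₖ 𝟙[N]) * Y * (invSqrt σ ⊗ₖ 𝟙[N])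
      ≤ (invSqrt σ ⊗ₖ 𝟙[N]) * t • (σ ⊗ₖ 𝟙[N]) * (invSqrt σ ⊗ₖ 𝟙[N]) := by
        simpa only [hX] using mul_mul_conjTranspose_mono h (invSqrt σ ⊗ₖ 𝟙[N])
    _ = t • (supportProj σ ⊗ₖ 𝟙[N]) := by
        rw [mul_smul_comm, smul_mul_assoc, ← kronecker_one_mul, ← kronecker_one_mul,
          invSqrt_mul_mul_invSqrt hσ]
    _ ≤ t • (1 ⊗ₖ 𝟙[N]) :=
        smul_le_smul_of_nonneg_left (kronecker_one_mono (supportProj_le_one σ)) ht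
    _ = t • 1 := by rw [Matrix.one_kronecker_one]

theorem le_smul_kronecker_one_iff (hY : 0 ≤ Y) (hσ : 0 ≤ σ) {t : ℝ} (ht : 0 ≤ t) :
    Y ≤ t • (σ ⊗ₖ 𝟙[N]) ↔ (∀ v : m → ℂ, σ *ᵥ v = 0 → partialTrace Y *ᵥ v = 0) ∧
      opNorm ((invSqrt σ ⊗ₖ 𝟙[N]) * Y * (invSqrt σ ⊗ₖ 𝟙[N])) ≤ t := by
  have hX : (invSqrt σ ⊗ₖ 𝟙[N])ᴴ = invSqrt σ ⊗ₖ 𝟙[N] := by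
    rw [conjTranspose_kronecker_one, conjTranspose_invSqrt]
  have hS : (CFC.sqrt σ ⊗ₖ 𝟙[N])ᴴ = CFC.sqrt σ ⊗ₖ 𝟙[N] := by
    rw [conjTranspose_kronecker_one, conjTranspose_sqrt]
  have hconj : 0 ≤ (invSqrt σ ⊗ₖ 𝟙[N]) * Y * (invSqrt σ ⊗ₖ 𝟙[N]) := by
    simpa only [Matrix.star_eq_conjTranspose, hX] using
      star_right_conjugate_nonneg hY (invSqrt σ ⊗ₖ 𝟙[N])
  rw [opNorm_le_iff hconj ht]
  refine ⟨fun h => ⟨fun v => partialTrace_ker_of_le hY h, invSqrt_conj_le hσ ht h⟩,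
    fun ⟨hker, h⟩ => ?_⟩
  calc Y = (CFC.sqrt σ ⊗ₖ 𝟙[N]) * ((invSqrt σ ⊗ₖ 𝟙[N]) * Y * (invSqrt σ ⊗ₖ 𝟙[N])) *
          (CFC.sqrt σ ⊗ₖ 𝟙[N]) := (sqrt_conj_invSqrt_conj hY hσ hker).symm
    _ ≤ (CFC.sqrt σ ⊗ₖ 𝟙[N]) * (t • 1) * (CFC.sqrt σ ⊗ₖ 𝟙[N]) := by
        simpa only [hS] using mul_mul_conjTranspose_mono h (CFC.sqrt σ ⊗ₖ 𝟙[N])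
    _ = t • (σ ⊗ₖ 𝟙[N]) := by
        rw [mul_smul_comm, mul_one, smul_mul_assoc, ← kronecker_one_mul, CFC.sqrt_mul_sqrt_self σ]

end PartialTrace

section Blocks

section DiagPart

variable {m N : Type*}

/-- The diagonal blocks of a matrix in `Mat_{mN}`, as an element of `Mat_m(ℂ^N)`. -/
def diagPart : Matrix (m × N) (m × N) ℂ →ₗ[ℂ] Matrix m m (N → ℂ) where
  toFun Y := Matrix.of fun i j k => Y (i, k) (j, k)
  map_add' _ _ := rfl
  map_smul' _ _ := rfl

theorem diagPart_apply (Y : Matrix (m × N) (m × N) ℂ) (i j : m) (k : N) :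
    diagPart Y i j k = Y (i, k) (j, k) := rfl

variable [Fintype m] [Fintype N] [DecidableEq N]

theorem diagPart_kronecker_one_mul_mul_apply (A B : Matrix m m ℂ) (Y : Matrix (m × N) (m × N) ℂ)
    (i j : m) : diagPart ((A ⊗ₖ 𝟙[N]) * Y * (B ⊗ₖ 𝟙[N])) i j =
      ∑ l, ∑ l', (A i l' * B l j) • diagPart Y l' l := by
  ext k
  have h := congrFun₂ (blockDiag_kronecker_one_mul_mul A B Y k) i j
  rw [Matrix.blockDiag_apply] at h
  simp only [diagPart_apply, h, Matrix.mul_apply, Finset.sum_mul, Finset.sum_apply, Pi.smul_apply,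
    smul_eq_mul, Matrix.blockDiag_apply, mul_right_comm]

end DiagPart

variable {q : ℕ} {N M : Type*}

section Embed

variable [DecidableEq N]

theorem embed_add (x y : Matrix (Fin q) (Fin q) (N → ℂ)) : embed (x + y) = embed x + embed y :=
  Matrix.blockDiagonal_add _ _

theorem embed_smul (c : ℂ) (x : Matrix (Fin q) (Fin q) (N → ℂ)) : embed (c • x) = c • embed x :=
  Matrix.blockDiagonal_smul c _

theorem diagPart_embed (x : Matrix (Fin q) (Fin q) (N → ℂ)) : diagPart (embed x) = x := by
  ext i j k
  exact Matrix.blockDiagonal_apply_eq (fun k => x.map fun v => v k) i j k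

end Embed

section BlockMap

variable [DecidableEq M]

/-- The amplification `id ⊗ u`, acting on all of `Mat_{qN}` by discarding the off-diagonal
blocks. -/
def blockMap (u : (N → ℂ) →ₗ[ℂ] (M → ℂ)) :
    Matrix (Fin q × N) (Fin q × N) ℂ →ₗ[ℂ] Matrix (Fin q × M) (Fin q × M) ℂ where
  toFun Y := embed ((diagPart Y).map u)
  map_add' Y Z := by rw [map_add, Matrix.map_add u (map_add u), embed_add]
  map_smul' c Y := by rw [map_smul, Matrix.map_smul u c (map_smul u c), embed_smul]; rfl

theorem blockMap_apply (u : (N → ℂ) →ₗ[ℂ] (M → ℂ)) (Y : Matrix (Fin q × N) (Fin q × N) ℂ) :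
    blockMap u Y = embed ((diagPart Y).map u) := rfl

theorem blockMap_embed [DecidableEq N] (u : (N → ℂ) →ₗ[ℂ] (M → ℂ))
    (x : Matrix (Fin q) (Fin q) (N → ℂ)) : blockMap u (embed x) = embed (x.map u) := by
  rw [blockMap_apply, diagPart_embed]

end BlockMap

variable [DecidableEq N]

theorem partialTrace_embed [Fintype N] (x : Matrix (Fin q) (Fin q) (N → ℂ)) :
    partialTrace (embed x) = marginal x := by
  rw [partialTrace, embed, Matrix.blockDiag_blockDiagonal]
  ext i j
  simp only [Matrix.sum_apply, Matrix.map_apply, marginal]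

theorem trace_embed_diagPart [Fintype N] (Y : Matrix (Fin q × N) (Fin q × N) ℂ) :
    (embed (diagPart Y)).trace = Y.trace := by
  simp [Matrix.trace, embed, Matrix.blockDiagonal_apply, diagPart_apply]

theorem embed_diagPart_eq_hadamard (Y : Matrix (Fin q × N) (Fin q × N) ℂ) :
    embed (diagPart Y) = (Matrix.vecMulVec 1 (star 1) ⊗ₖ 𝟙[N]).hadamard Y := by
  ext ⟨i, k⟩ ⟨j, l⟩
  by_cases h : k = l <;> simp [embed, Matrix.blockDiagonal_apply, diagPart_apply, h]

theorem embed_diagPart_nonneg [Finite N] {Y : Matrix (Fin q × N) (Fin q × N) ℂ} (hY : 0 ≤ Y) :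
    0 ≤ embed (diagPart Y) := by
  rw [embed_diagPart_eq_hadamard]
  exact Matrix.nonneg_iff_posSemidef.2
    (((Matrix.posSemidef_vecMulVec_self_star 1).kronecker Matrix.PosSemidef.one).hadamard
      (Matrix.nonneg_iff_posSemidef.1 hY))

theorem embed_diagPart_mono [Finite N] {Y Z : Matrix (Fin q × N) (Fin q × N) ℂ} (h : Y ≤ Z) :
    embed (diagPart Y) ≤ embed (diagPart Z) := by
  have h' := embed_diagPart_nonneg (sub_nonneg.2 h)
  rw [map_sub, sub_eq_add_neg, embed_add, ← neg_one_smul ℂ, embed_smul, neg_one_smul,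
    ← sub_eq_add_neg] at h'
  exact sub_nonneg.1 h'

theorem embed_diagPart_kronecker_one (C : Matrix (Fin q) (Fin q) ℂ) :
    embed (diagPart (C ⊗ₖ 𝟙[N])) = C ⊗ₖ 𝟙[N] := by
  ext ⟨i, k⟩ ⟨j, l⟩
  by_cases h : k = l <;> simp [embed, Matrix.blockDiagonal_apply, diagPart_apply, h]

variable [Fintype N]

theorem embed_diagPart_kronecker_one_mul_mul (A B : Matrix (Fin q) (Fin q) ℂ)
    (x : Matrix (Fin q) (Fin q) (N → ℂ)) :
    embed (diagPart ((A ⊗ₖ 𝟙[N]) * embed x * (B ⊗ₖ 𝟙[N]))) =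
      (A ⊗ₖ 𝟙[N]) * embed x * (B ⊗ₖ 𝟙[N]) := by
  have h : (A ⊗ₖ 𝟙[N]) * embed x * (B ⊗ₖ 𝟙[N]) =
      embed (Matrix.of fun i j k => (A * (x.map fun v => v k) * B) i j) := by
    simp only [embed, Matrix.kronecker_one, ← Matrix.blockDiagonal_mul]
    rfl
  rw [h, diagPart_embed]

theorem blockMap_kronecker_one_mul_mul [Fintype M] [DecidableEq M] (u : (N → ℂ) →ₗ[ℂ] (M → ℂ))
    (A B : Matrix (Fin q) (Fin q) ℂ) (Y : Matrix (Fin q × N) (Fin q × N) ℂ) :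
    blockMap u ((A ⊗ₖ 𝟙[N]) * Y * (B ⊗ₖ 𝟙[N])) = (A ⊗ₖ 𝟙[M]) * blockMap u Y * (B ⊗ₖ 𝟙[M]) := by
  rw [blockMap_apply, blockMap_apply, ← embed_diagPart_kronecker_one_mul_mul]
  congr 1
  refine Matrix.ext fun i j => ?_
  rw [Matrix.map_apply, diagPart_kronecker_one_mul_mul_apply, diagPart_kronecker_one_mul_mul_apply,
    diagPart_embed]
  simp only [map_sum, map_smul, Matrix.map_apply]

end Blocks

section MinEntropy

theorem IsState.nonneg {n : Type*} [Fintype n] {σ : Matrix n n ℂ} (h : IsState σ) : 0 ≤ σ :=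
  Matrix.nonneg_iff_posSemidef.2 h.1

variable {q : ℕ} {N : Type*} [Fintype N] [DecidableEq N] {ρ : Matrix (Fin q) (Fin q) (N → ℂ)}

theorem isState_marginal (hρ : IsCQState ρ) : IsState (marginal ρ) := by
  rw [← partialTrace_embed]
  exact ⟨Matrix.nonneg_iff_posSemidef.1 (partialTrace_nonneg hρ.nonneg),
    (trace_partialTrace _).trans hρ.2⟩

/-- The set whose infimum is `2 ^ (-H_min(N|Q))`. -/
def entropyCandidates (ρ : Matrix (Fin q) (Fin q) (N → ℂ)) : Set ℝ :=
  {t : ℝ | ∃ σ : Matrix (Fin q) (Fin q) ℂ, IsState σ ∧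
    (∀ v : Fin q → ℂ, σ.mulVec v = 0 → (marginal ρ).mulVec v = 0) ∧
    t = opNorm ((invSqrt σ ⊗ₖ 𝟙[N]) * embed ρ * (invSqrt σ ⊗ₖ 𝟙[N]))}

theorem entropyCandidates_nonempty (hρ : IsCQState ρ) : (entropyCandidates ρ).Nonempty :=
  ⟨_, marginal ρ, isState_marginal hρ, fun _ => id, rfl⟩

theorem exists_isState_of_mem_entropyCandidates (hρ : IsCQState ρ) {t : ℝ}
    (ht : t ∈ entropyCandidates ρ) : ∃ σ, IsState σ ∧ embed ρ ≤ t • (σ ⊗ₖ 𝟙[N]) := by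
  obtain ⟨σ, hσ, hker, rfl⟩ := ht
  rw [← partialTrace_embed] at hker
  exact ⟨σ, hσ, (le_smul_kronecker_one_iff hρ.nonneg hσ.nonneg (opNorm_nonneg _)).2
    ⟨hker, le_rfl⟩⟩

theorem exists_mem_entropyCandidates_le (hρ : IsCQState ρ) {σ : Matrix (Fin q) (Fin q) ℂ}
    (hσ : IsState σ) {t : ℝ} (ht : 0 ≤ t) (h : embed ρ ≤ t • (σ ⊗ₖ 𝟙[N])) :
    ∃ s ∈ entropyCandidates ρ, s ≤ t := by
  obtain ⟨hker, hle⟩ := (le_smul_kronecker_one_iff hρ.nonneg hσ.nonneg ht).1 h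
  rw [partialTrace_embed] at hker
  exact ⟨_, ⟨σ, hσ, hker, rfl⟩, hle⟩

theorem one_le_mul_card (hρ : IsCQState ρ) {σ : Matrix (Fin q) (Fin q) ℂ} (hσ : IsState σ) {t : ℝ}
    (h : embed ρ ≤ t • (σ ⊗ₖ 𝟙[N])) : 1 ≤ t * Fintype.card N := by
  have htrace := re_trace_mono h
  rw [hρ.2, Matrix.trace_smul, Matrix.trace_kronecker, hσ.2] at htrace
  simpa using htrace

theorem inv_card_mem_lowerBounds (hρ : IsCQState ρ) :
    (Fintype.card N : ℝ)⁻¹ ∈ lowerBounds (entropyCandidates ρ) := fun t ht => by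
  obtain ⟨σ, hσ, hle⟩ := exists_isState_of_mem_entropyCandidates hρ ht
  have h := one_le_mul_card hρ hσ hle
  have ht0 : 0 < t := pos_of_mul_pos_left (one_pos.trans_le h) (Nat.cast_nonneg _)
  exact inv_le_of_inv_le₀ ht0 ((inv_le_iff_one_le_mul₀' ht0).2 h)

theorem sInf_entropyCandidates_pos (hρ : IsCQState ρ) : 0 < sInf (entropyCandidates ρ) := by
  obtain ⟨t, ht⟩ := entropyCandidates_nonempty hρ
  obtain ⟨σ, hσ, hle⟩ := exists_isState_of_mem_entropyCandidates hρ ht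
  have hcard : (0 : ℝ) < Fintype.card N := by
    refine (Nat.cast_nonneg _).lt_of_ne fun h0 => ?_
    have h := one_le_mul_card hρ hσ hle
    rw [← h0, mul_zero] at h
    exact h.not_gt one_pos
  exact (inv_pos.2 hcard).trans_le (le_csInf ⟨t, ht⟩ (inv_card_mem_lowerBounds hρ))

theorem le_condMinEntropy_iff_sInf_le (hρ : IsCQState ρ) {κ : ℝ} :
    κ ≤ condMinEntropy ρ ↔ sInf (entropyCandidates ρ) ≤ 2 ^ (-κ) := by
  rw [← Real.logb_le_iff_le_rpow one_lt_two (sInf_entropyCandidates_pos hρ), le_neg]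
  rfl

theorem le_condMinEntropy (hρ : IsCQState ρ) {σ : Matrix (Fin q) (Fin q) ℂ} (hσ : IsState σ)
    {κ : ℝ} (h : embed ρ ≤ (2 : ℝ) ^ (-κ) • (σ ⊗ₖ 𝟙[N])) : κ ≤ condMinEntropy ρ := by
  obtain ⟨s, hs, hle⟩ := exists_mem_entropyCandidates_le hρ hσ (by positivity) h
  exact (le_condMinEntropy_iff_sInf_le hρ).2
    ((csInf_le ⟨_, inv_card_mem_lowerBounds hρ⟩ hs).trans hle)

theorem exists_isState_of_le_condMinEntropy (hρ : IsCQState ρ) {κ : ℝ} (h : κ ≤ condMinEntropy ρ)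
    {r : ℝ} (hr : 1 < r) :
    ∃ σ, IsState σ ∧ embed ρ ≤ (r * (2 : ℝ) ^ (-κ)) • (σ ⊗ₖ 𝟙[N]) := by
  have hlt : sInf (entropyCandidates ρ) < r * 2 ^ (-κ) :=
    ((le_condMinEntropy_iff_sInf_le hρ).1 h).trans_lt (lt_mul_of_one_lt_left (by positivity) hr)
  obtain ⟨t, ht, htr⟩ := exists_lt_of_csInf_lt (entropyCandidates_nonempty hρ) hlt
  obtain ⟨σ, hσ, hle⟩ := exists_isState_of_mem_entropyCandidates hρ ht
  exact ⟨σ, hσ, hle.trans (smul_le_smul_of_nonneg_right htr.le (kronecker_one_nonneg hσ.nonneg))⟩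

end MinEntropy

section Factorizations

variable {q : ℕ} {N : Type*} [Fintype N]

theorem Gam_mul_conjTranspose_self (a : Matrix (Fin q × N) (Fin q × N) ℂ) :
    Gam a * (Gam a)ᴴ = partialTrace (a * aᴴ) := by
  ext i j
  simp only [partialTrace_apply, Matrix.mul_apply, Matrix.conjTranspose_apply, Gam,
    Matrix.of_apply, Fintype.sum_prod_type]
  exact Finset.sum_comm

variable [DecidableEq N]

theorem factorNorm_nonneg (K : ℝ) (a : Matrix (Fin q × N) (Fin q × N) ℂ) : 0 ≤ factorNorm K a :=
  le_max_of_le_right (opNorm_nonneg _)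

theorem factorNorm_smul (K r : ℝ) (a : Matrix (Fin q × N) (Fin q × N) ℂ) :
    factorNorm K (r • a) = |r| * factorNorm K a := by
  have h : Gam (r • a) = r • Gam a := rfl
  rw [factorNorm, factorNorm, h, opNorm_smul, opNorm_smul, mul_max_of_nonneg _ _ (abs_nonneg r),
    mul_left_comm]

variable {K : ℝ} (hK : 0 < K)
include hK

theorem eq_zero_of_factorNorm_eq_zero {a : Matrix (Fin q × N) (Fin q × N) ℂ}
    (h : factorNorm K a = 0) : a = 0 := by
  have h' : √K * opNorm a ≤ 0 := h ▸ le_max_left _ _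
  exact opNorm_eq_zero.1 (le_antisymm (nonpos_of_mul_nonpos_right h' (Real.sqrt_pos.2 hK))
    (opNorm_nonneg a))

theorem factorNorm_le_sqrt_iff {c : ℝ} (hc : 0 ≤ c) {a : Matrix (Fin q × N) (Fin q × N) ℂ} :
    factorNorm K a ≤ √c ↔ a * aᴴ ≤ (c * K⁻¹) • (1 : Matrix (Fin q × N) (Fin q × N) ℂ) ∧
      partialTrace (a * aᴴ) ≤ c • (1 : Matrix (Fin q) (Fin q) ℂ) := by
  rw [factorNorm, max_le_iff, mul_comm, ← le_div_iff₀ (Real.sqrt_pos.2 hK),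
    opNorm_le_iff_mul_conjTranspose_le (by positivity),
    opNorm_le_iff_mul_conjTranspose_le (Real.sqrt_nonneg c), Gam_mul_conjTranspose_self, div_pow,
    Real.sq_sqrt hc, Real.sq_sqrt hK.le, div_eq_mul_inv]

theorem capCap_le_one {x : Matrix (Fin q) (Fin q) (N → ℂ)} (hx : 0 ≤ embed x)
    (hxK : embed x ≤ K⁻¹ • (1 : Matrix (Fin q × N) (Fin q × N) ℂ)) (hx1 : marginal x ≤ 1) :
    capCap N K q x ≤ 1 := by
  set a := CFC.sqrt (embed x)
  have ha : embed x = a * aᴴ := by rw [conjTranspose_sqrt, CFC.sqrt_mul_sqrt_self (embed x)]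
  have hnorm : factorNorm K a ≤ 1 := by
    rw [← Real.sqrt_one, factorNorm_le_sqrt_iff hK zero_le_one, ← ha, partialTrace_embed, one_mul,
      one_smul]
    exact ⟨hxK, hx1⟩
  refine iInf₂_le_of_le a a (iInf_le_of_le ha ?_)
  exact ENNReal.ofReal_le_one.2 (mul_le_one₀ hnorm (factorNorm_nonneg K a) hnorm)

theorem exists_balanced_factorization {a b : Matrix (Fin q × N) (Fin q × N) ℂ} {c : ℝ} (hc : 0 < c)
    (h : factorNorm K a * factorNorm K b ≤ c) :
    ∃ a' b' : Matrix (Fin q × N) (Fin q × N) ℂ, a * bᴴ = a' * b'ᴴ ∧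
      factorNorm K a' ≤ √c ∧ factorNorm K b' ≤ √c := by
  have hc' : 0 < √c := Real.sqrt_pos.2 hc
  rcases (factorNorm_nonneg K a).eq_or_lt with h0 | h0
  · have ha : a = 0 := eq_zero_of_factorNorm_eq_zero hK h0.symm
    have hz : factorNorm K (0 : Matrix (Fin q × N) (Fin q × N) ℂ) ≤ √c := by
      rw [← ha, ← h0]
      exact hc'.le
    exact ⟨0, 0, by rw [ha, zero_mul, zero_mul], hz, hz⟩
  · set r := √c / factorNorm K a with hr
    have hr0 : 0 < r := div_pos hc' h0
    refine ⟨r • a, r⁻¹ • b, ?_, ?_, ?_⟩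
    · rw [Matrix.conjTranspose_smul, smul_mul_smul_comm, star_trivial, mul_inv_cancel₀ hr0.ne',
        one_smul]
    · rw [factorNorm_smul, abs_of_pos hr0, hr, div_mul_cancel₀ _ h0.ne']
    · rwa [factorNorm_smul, abs_of_pos (inv_pos.2 hr0), hr, inv_div, div_mul_eq_mul_div,
        div_le_iff₀ hc', Real.mul_self_sqrt hc.le]

theorem exists_factorization {x : Matrix (Fin q) (Fin q) (N → ℂ)} (hx : capCap N K q x ≤ 1) {c : ℝ}
    (hc : 1 < c) :
    ∃ a b : Matrix (Fin q × N) (Fin q × N) ℂ, embed x = a * bᴴ ∧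
      factorNorm K a ≤ √c ∧ factorNorm K b ≤ √c := by
  have hlt : capCap N K q x < ENNReal.ofReal c := hx.trans_lt (ENNReal.one_lt_ofReal.2 hc)
  simp only [capCap, iInf_lt_iff] at hlt
  obtain ⟨a, b, hab, h⟩ := hlt
  have hc0 : 0 < c := one_pos.trans hc
  rw [hab]
  exact exists_balanced_factorization hK hc0 ((ENNReal.ofReal_lt_ofReal_iff hc0).1 h).le

variable {c : ℝ} (hc : 0 ≤ c) {a : Matrix (Fin q × N) (Fin q × N) ℂ} (ha : factorNorm K a ≤ √c)
  (A : Matrix (Fin q) (Fin q) ℂ)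
include hc ha

theorem kronecker_one_mul_factor_le :
    ((A ⊗ₖ 𝟙[N]) * a) * ((A ⊗ₖ 𝟙[N]) * a)ᴴ ≤ (c * K⁻¹) • ((A * Aᴴ) ⊗ₖ 𝟙[N]) :=
  calc ((A ⊗ₖ 𝟙[N]) * a) * ((A ⊗ₖ 𝟙[N]) * a)ᴴ = (A ⊗ₖ 𝟙[N]) * (a * aᴴ) * (A ⊗ₖ 𝟙[N])ᴴ := by
        simp only [Matrix.conjTranspose_mul, mul_assoc]
    _ ≤ (A ⊗ₖ 𝟙[N]) * (c * K⁻¹) • 1 * (A ⊗ₖ 𝟙[N])ᴴ :=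
        mul_mul_conjTranspose_mono ((factorNorm_le_sqrt_iff hK hc).1 ha).1 _
    _ = (c * K⁻¹) • ((A * Aᴴ) ⊗ₖ 𝟙[N]) := by
        rw [mul_smul_comm, smul_mul_assoc, mul_one, conjTranspose_kronecker_one,
          kronecker_one_mul]

theorem re_trace_kronecker_one_mul_factor_le :
    (((A ⊗ₖ 𝟙[N]) * a) * ((A ⊗ₖ 𝟙[N]) * a)ᴴ).trace.re ≤ c * (A * Aᴴ).trace.re :=
  calc (((A ⊗ₖ 𝟙[N]) * a) * ((A ⊗ₖ 𝟙[N]) * a)ᴴ).trace.re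
      = ((A ⊗ₖ 𝟙[N]) * (a * aᴴ) * (Aᴴ ⊗ₖ 𝟙[N])).trace.re := by
        rw [Matrix.conjTranspose_mul, conjTranspose_kronecker_one]
        simp only [mul_assoc]
    _ = (A * partialTrace (a * aᴴ) * Aᴴ).trace.re := by
        rw [← trace_partialTrace, partialTrace_kronecker_one_mul_mul]
    _ ≤ (A * c • 1 * Aᴴ).trace.re := re_trace_mono
        (mul_mul_conjTranspose_mono ((factorNorm_le_sqrt_iff hK hc).1 ha).2 A)
    _ = c * (A * Aᴴ).trace.re := by
        rw [mul_smul_comm, smul_mul_assoc, mul_one, Matrix.trace_smul, Complex.smul_re, smul_eq_mul]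

end Factorizations

section EllOne

variable {q : ℕ} {M : Type*} [Fintype M] [DecidableEq M]

theorem traceNorm_le_of_ellOne_le {y : Matrix (Fin q) (Fin q) (M → ℂ)} {ε : ℝ} (hε : 0 ≤ ε)
    (hy : ellOne M q y ≤ ENNReal.ofReal ε) {A B : Matrix (Fin q) (Fin q) ℂ} (hA : hsNorm A ≤ 1)
    (hB : hsNorm B ≤ 1) : traceNorm ((A ⊗ₖ 𝟙[M]) * embed y * (B ⊗ₖ 𝟙[M])) ≤ ε := by
  refine (ENNReal.ofReal_le_ofReal_iff hε).1 (le_trans ?_ hy)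
  exact le_iSup₂_of_le A B (le_iSup₂_of_le hA hB le_rfl)

theorem traceNorm_le_hsNorm_mul_hsNorm_mul {y : Matrix (Fin q) (Fin q) (M → ℂ)} {ε : ℝ}
    (hε : 0 ≤ ε) (hy : ellOne M q y ≤ ENNReal.ofReal ε) (A B : Matrix (Fin q) (Fin q) ℂ) :
    traceNorm ((A ⊗ₖ 𝟙[M]) * embed y * (B ⊗ₖ 𝟙[M])) ≤ hsNorm A * hsNorm B * ε := by
  obtain ⟨A', hA', hAA'⟩ := exists_hsNorm_le_one_smul_eq A
  obtain ⟨B', hB', hBB'⟩ := exists_hsNorm_le_one_smul_eq B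
  have hscale : (A ⊗ₖ 𝟙[M]) * embed y * (B ⊗ₖ 𝟙[M]) = ((hsNorm A : ℂ) * hsNorm B) •
      ((A' ⊗ₖ 𝟙[M]) * embed y * (B' ⊗ₖ 𝟙[M])) := by
    conv_lhs => rw [← hAA', ← hBB']
    rw [Matrix.smul_kronecker, Matrix.smul_kronecker, smul_mul_assoc, smul_mul_smul_comm]
  rw [hscale, traceNorm_smul, norm_mul, Complex.norm_of_nonneg (hsNorm_nonneg A),
    Complex.norm_of_nonneg (hsNorm_nonneg B)]
  exact mul_le_mul_of_nonneg_left (traceNorm_le_of_ellOne_le hε hy hA' hB')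
    (mul_nonneg (hsNorm_nonneg A) (hsNorm_nonneg B))

end EllOne

section MinEntropyBound

variable {N M D : Type*} [Fintype N] [DecidableEq N] [Fintype M] [DecidableEq M] [Fintype D]

/-- The amplifications `id ⊗ u` map every classical-quantum state of conditional min-entropy at
least `κ` to a matrix of trace norm at most `ε`. For `u = Delta f` this says that `f` is a
quantum-proof `(κ, ε)`-extractor. -/
def IsBoundedOnMinEntropy (κ ε : ℝ) (u : (N → ℂ) →ₗ[ℂ] (M → ℂ)) : Prop :=
  ∀ (q : ℕ) (ρ : Matrix (Fin q) (Fin q) (N → ℂ)), IsCQState ρ → κ ≤ condMinEntropy ρ →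
    traceNorm (embed (ρ.map u)) ≤ ε

theorem isQuantumProof_iff {k ε : ℝ} {f : D → N → M} :
    IsQuantumProof k ε f ↔ IsBoundedOnMinEntropy k ε (Delta f) := by
  have h (q : ℕ) (ρ : Matrix (Fin q) (Fin q) (N → ℂ)) :
      (Fintype.card D : ℂ)⁻¹ • ∑ s, ρ.map (pushMap (f s)) -
        (marginal ρ).map (fun c => c • uniform M) = ρ.map (Delta f) := by
    ext i j y
    simp [Delta, marginal, Matrix.sum_apply]
  simp only [IsQuantumProof, IsBoundedOnMinEntropy, h]

end MinEntropyBound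

section OfCbNorm

variable {q : ℕ} {N M : Type*} [Fintype N] [DecidableEq N] [Fintype M] [DecidableEq M]
  {K : ℝ} (hK : 0 < K) {ρ : Matrix (Fin q) (Fin q) (N → ℂ)} (hρ : 0 ≤ embed ρ)
  {σ : Matrix (Fin q) (Fin q) ℂ} (hσ : 0 ≤ σ) (hρσ : embed ρ ≤ K⁻¹ • (σ ⊗ₖ 𝟙[N]))
  (hmarg : marginal ρ ≤ σ)

theorem le_cbNorm {E F : Type*} [AddCommGroup E] [Module ℂ E] [AddCommGroup F] [Module ℂ F]
    (normE : MatrixNorms E) (normF : MatrixNorms F) (u : E →ₗ[ℂ] F) {x : Matrix (Fin q) (Fin q) E}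
    (hx : normE q x ≤ 1) : normF q (x.map u) ≤ cbNorm normE normF u :=
  le_iSup₂_of_le q x (le_iSup_of_le hx le_rfl)

include hK hρ hσ hρσ hmarg

theorem capCap_diagPart_invSqrt_conj_le_one :
    capCap N K q (diagPart ((invSqrt σ ⊗ₖ 𝟙[N]) * embed ρ * (invSqrt σ ⊗ₖ 𝟙[N]))) ≤ 1 := by
  have hX : (invSqrt σ ⊗ₖ 𝟙[N])ᴴ = invSqrt σ ⊗ₖ 𝟙[N] := by
    rw [conjTranspose_kronecker_one, conjTranspose_invSqrt]
  refine capCap_le_one hK ?_ ?_ ?_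
  · rw [embed_diagPart_kronecker_one_mul_mul]
    simpa only [Matrix.star_eq_conjTranspose, hX] using
      star_right_conjugate_nonneg hρ (invSqrt σ ⊗ₖ 𝟙[N])
  · rw [embed_diagPart_kronecker_one_mul_mul]
    exact invSqrt_conj_le hσ (inv_pos.2 hK).le hρσ
  · calc marginal (diagPart ((invSqrt σ ⊗ₖ 𝟙[N]) * embed ρ * (invSqrt σ ⊗ₖ 𝟙[N])))
        = invSqrt σ * marginal ρ * (invSqrt σ)ᴴ := by
          rw [← partialTrace_embed, embed_diagPart_kronecker_one_mul_mul,
            partialTrace_kronecker_one_mul_mul, partialTrace_embed, conjTranspose_invSqrt]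
      _ ≤ invSqrt σ * σ * (invSqrt σ)ᴴ := mul_mul_conjTranspose_mono hmarg _
      _ = supportProj σ := by rw [conjTranspose_invSqrt, invSqrt_mul_mul_invSqrt hσ]
      _ ≤ 1 := supportProj_le_one σ

theorem traceNorm_embed_map_le_of_cbNorm_le {u : (N → ℂ) →ₗ[ℂ] (M → ℂ)} {ε : ℝ} (hε : 0 ≤ ε)
    (hu : cbNorm (capCap N K) (ellOne M) u ≤ ENNReal.ofReal ε) :
    traceNorm (embed (ρ.map u)) ≤ σ.trace.re * ε := by
  set x := diagPart ((invSqrt σ ⊗ₖ 𝟙[N]) * embed ρ * (invSqrt σ ⊗ₖ 𝟙[N])) with hx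
  have hxε : ellOne M q (x.map u) ≤ ENNReal.ofReal ε :=
    (le_cbNorm _ _ u (capCap_diagPart_invSqrt_conj_le_one hK hρ hσ hρσ hmarg)).trans hu
  have hconj : (CFC.sqrt σ ⊗ₖ 𝟙[N]) * embed x * (CFC.sqrt σ ⊗ₖ 𝟙[N]) = embed ρ := by
    rw [hx, embed_diagPart_kronecker_one_mul_mul]
    exact sqrt_conj_invSqrt_conj hρ hσ fun v => partialTrace_ker_of_le hρ hρσ
  have hmap : embed (ρ.map u) = (CFC.sqrt σ ⊗ₖ 𝟙[M]) * embed (x.map u) * (CFC.sqrt σ ⊗ₖ 𝟙[M]) := by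
    rw [← blockMap_embed, ← hconj, blockMap_kronecker_one_mul_mul, blockMap_embed]
  have hsqrt : hsNorm (CFC.sqrt σ) * hsNorm (CFC.sqrt σ) = σ.trace.re := by
    rw [← sq, hsNorm_sq, conjTranspose_sqrt, CFC.sqrt_mul_sqrt_self σ]
  rw [hmap, ← hsqrt]
  exact traceNorm_le_hsNorm_mul_hsNorm_mul hε hxε _ _

omit hK hρ hσ hρσ hmarg

theorem isBoundedOnMinEntropy_of_cbNorm_le {k ε : ℝ} (hε : 0 ≤ ε) {u : (N → ℂ) →ₗ[ℂ] (M → ℂ)}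
    (hu : cbNorm (capCap N (2 ^ k)) (ellOne M) u ≤ ENNReal.ofReal ε) :
    IsBoundedOnMinEntropy k (2 * ε) u := by
  refine fun q ρ hρ hk => (le_iff_forall_one_lt_le_mul₀ (by positivity)).2 fun r hr => ?_
  obtain ⟨σ₀, hσ₀, hle⟩ := exists_isState_of_le_condMinEntropy hρ hk hr
  have hr0 : 0 ≤ r • σ₀ := smul_nonneg (by positivity) hσ₀.nonneg
  have hρ₀ : 0 ≤ marginal ρ := (isState_marginal hρ).nonneg
  have hρσ : embed ρ ≤ ((2 : ℝ) ^ k)⁻¹ • ((r • σ₀ + marginal ρ) ⊗ₖ 𝟙[N]) := by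
    rw [mul_comm, mul_smul, ← Matrix.smul_kronecker, Real.rpow_neg zero_le_two] at hle
    exact hle.trans (smul_le_smul_of_nonneg_left
      (kronecker_one_mono (le_add_of_nonneg_right hρ₀)) (by positivity))
  have htrace : (r • σ₀ + marginal ρ).trace.re = r + 1 := by
    rw [Matrix.trace_add, Matrix.trace_smul, hσ₀.2, (isState_marginal hρ).2]
    simp
  calc traceNorm (embed (ρ.map u)) ≤ (r • σ₀ + marginal ρ).trace.re * ε :=
        traceNorm_embed_map_le_of_cbNorm_le (by positivity) hρ.nonneg (add_nonneg hr0 hρ₀) hρσ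
          (le_add_of_nonneg_left hr0) hε hu
    _ ≤ 2 * ε * r := by
        rw [htrace]
        nlinarith

end OfCbNorm

section Polarization

variable {n : Type*} [Fintype n] (a b : Matrix n n ℂ)

theorem add_smul_mul_conjTranspose {z : ℂ} (hz : ‖z‖ = 1) :
    (a + z • b) * (a + z • b)ᴴ = a * aᴴ + star z • (a * bᴴ) + z • (b * aᴴ) + b * bᴴ := by
  have hz' : z * star z = 1 := by rw [Complex.star_def, Complex.mul_conj', hz]; simp
  rw [Matrix.conjTranspose_add, Matrix.conjTranspose_smul, add_mul, mul_add, mul_add,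
    smul_mul_smul_comm, hz', one_smul, mul_smul_comm, smul_mul_assoc, ← add_assoc]

theorem mul_conjTranspose_eq_sum :
    a * bᴴ = (4 : ℂ)⁻¹ • ∑ j : Fin 4,
      Complex.I ^ (j : ℕ) •
        ((a + Complex.I ^ (j : ℕ) • b) * (a + Complex.I ^ (j : ℕ) • b)ᴴ) := by
  rw [eq_inv_smul_iff₀ (by norm_num)]
  have hexpand (j : Fin 4) := add_smul_mul_conjTranspose a b (z := Complex.I ^ (j : ℕ))
    (by rw [norm_pow, Complex.norm_I, one_pow])
  simp only [hexpand, Fin.sum_univ_four, Fin.val_zero, Fin.val_one, Fin.val_two,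
    show ((3 : Fin 4) : ℕ) = 3 from rfl, pow_zero, pow_one, Complex.I_sq, Complex.I_pow_three,
    Complex.star_def, map_one, map_neg, Complex.conj_I]
  match_scalars <;> ring_nf <;> simp only [Complex.I_sq] <;> ring

theorem add_smul_mul_conjTranspose_le {z : ℂ} (hz : ‖z‖ = 1) :
    (a + z • b) * (a + z • b)ᴴ ≤ (2 : ℝ) • (a * aᴴ + b * bᴴ) := by
  have hz' : ‖-z‖ = 1 := by rwa [norm_neg]
  have h : (2 : ℝ) • (a * aᴴ + b * bᴴ) - (a + z • b) * (a + z • b)ᴴ =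
      (a + -z • b) * (a + -z • b)ᴴ := by
    rw [add_smul_mul_conjTranspose a b hz, add_smul_mul_conjTranspose a b hz', star_neg, neg_smul,
      neg_smul, two_smul]
    abel
  rw [← sub_nonneg, h]
  exact nonneg_mul_conjTranspose _

variable {p : Type*} [Fintype p] [DecidableEq p] (Φ : Matrix n n ℂ →ₗ[ℂ] Matrix p p ℂ)

theorem traceNorm_map_mul_conjTranspose_le {r : ℝ}
    (h : ∀ z : ℂ, ‖z‖ = 1 → traceNorm (Φ ((a + z • b) * (a + z • b)ᴴ)) ≤ r) :
    traceNorm (Φ (a * bᴴ)) ≤ r := by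
  have hI (j : Fin 4) : ‖Complex.I ^ (j : ℕ)‖ = 1 := by rw [norm_pow, Complex.norm_I, one_pow]
  rw [mul_conjTranspose_eq_sum, map_smul, map_sum, traceNorm_smul, norm_inv, Complex.norm_ofNat,
    inv_mul_le_iff₀ four_pos]
  refine (traceNorm_sum_le _ _).trans ((Finset.sum_le_card_nsmul _ _ r fun j _ => ?_).trans ?_)
  · rw [map_smul, traceNorm_smul, hI, one_mul]
    exact h _ (hI j)
  · simp

end Polarization

section Domination

variable {m N p : Type*} [Fintype m] [Fintype N] [DecidableEq N] [Fintype p] [DecidableEq p]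

/-- Every state on `m × N` dominated by `t • (σ ⊗ 1)` for some state `σ` on `m` is mapped by `Φ` to
a matrix of trace norm at most `ε`. -/
def IsBoundedOnDominated (t ε : ℝ) (Φ : Matrix (m × N) (m × N) ℂ →ₗ[ℂ] Matrix p p ℂ) : Prop :=
  ∀ (Y : Matrix (m × N) (m × N) ℂ) (σ : Matrix m m ℂ), IsState Y → IsState σ →
    Y ≤ t • (σ ⊗ₖ 𝟙[N]) → traceNorm (Φ Y) ≤ ε

theorem isState_inv_card_smul_kronecker_one [Nonempty N] {σ : Matrix m m ℂ} (hσ : IsState σ) :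
    IsState ((Fintype.card N : ℝ)⁻¹ • (σ ⊗ₖ 𝟙[N])) := by
  refine ⟨Matrix.nonneg_iff_posSemidef.1
    (smul_nonneg (by positivity) (kronecker_one_nonneg hσ.nonneg)), ?_⟩
  rw [Matrix.trace_smul, Matrix.trace_kronecker, hσ.2, Matrix.trace_one]
  simp

theorem exists_isState_ge {C : Matrix m m ℂ} (hC : 0 ≤ C) (hC0 : C ≠ 0) (htrace : C.trace.re ≤ 1) :
    ∃ σ, IsState σ ∧ C ≤ σ := by
  have hpos : 0 < C.trace.re := by
    refine (re_trace_nonneg hC).lt_of_ne' fun h => hC0 ?_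
    rw [← (Matrix.nonneg_iff_posSemidef.1 hC).trace_eq_zero_iff, ← ofReal_re_trace hC, h,
      Complex.ofReal_zero]
  refine ⟨C.trace.re⁻¹ • C, ⟨Matrix.nonneg_iff_posSemidef.1
    (smul_nonneg (inv_pos.2 hpos).le hC), ?_⟩, ?_⟩
  · rw [Matrix.trace_smul, ← ofReal_re_trace hC, Complex.real_smul, Complex.ofReal_re,
      ← Complex.ofReal_mul, inv_mul_cancel₀ hpos.ne', Complex.ofReal_one]
  · simpa only [one_smul] using
      smul_le_smul_of_nonneg_right ((one_le_inv₀ hpos).2 htrace) hC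

variable {t ε : ℝ} {Φ : Matrix (m × N) (m × N) ℂ →ₗ[ℂ] Matrix p p ℂ}
  {Y : Matrix (m × N) (m × N) ℂ} (hY : 0 ≤ Y)
include hY

theorem IsBoundedOnDominated.traceNorm_le_of_re_trace_le_one [Nonempty N]
    (hΦ : IsBoundedOnDominated (2 * t) ε Φ) (ht : (Fintype.card N : ℝ)⁻¹ ≤ t)
    {σ : Matrix m m ℂ} (hσ : IsState σ) (hYσ : Y ≤ t • (σ ⊗ₖ 𝟙[N])) (htrace : Y.trace.re ≤ 1) :
    traceNorm (Φ Y) ≤ 2 * ε := by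
  have ht0 : 0 ≤ t := le_trans (by positivity) ht
  have hσ1 : 0 ≤ σ ⊗ₖ 𝟙[N] := kronecker_one_nonneg hσ.nonneg
  set F := (Fintype.card N : ℝ)⁻¹ • (σ ⊗ₖ 𝟙[N])
  have hF : IsState F := isState_inv_card_smul_kronecker_one hσ
  have hFσ : F ≤ t • (σ ⊗ₖ 𝟙[N]) := smul_le_smul_of_nonneg_right ht hσ1
  set s := 1 - Y.trace.re with hs
  have hs0 : 0 ≤ s := sub_nonneg.2 htrace
  have hs1 : s ≤ 1 := sub_le_self 1 (re_trace_nonneg hY)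
  have hZ : IsState (Y + s • F) := by
    refine ⟨Matrix.nonneg_iff_posSemidef.1 (add_nonneg hY (smul_nonneg hs0 hF.nonneg)), ?_⟩
    rw [Matrix.trace_add, Matrix.trace_smul, hF.2, ← ofReal_re_trace hY, hs]
    simp
  have hZσ : Y + s • F ≤ (2 * t) • (σ ⊗ₖ 𝟙[N]) := by
    rw [two_mul, add_smul]
    exact add_le_add hYσ ((smul_le_of_le_one_left hF.nonneg hs1).trans hFσ)
  have hF2 : F ≤ (2 * t) • (σ ⊗ₖ 𝟙[N]) :=
    hFσ.trans (smul_le_smul_of_nonneg_right (by linarith) hσ1)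
  calc traceNorm (Φ Y) = traceNorm (Φ (Y + s • F) + (-s : ℂ) • Φ F) := by
        rw [← map_smul, ← map_add, neg_smul, Complex.coe_smul, add_neg_cancel_right]
    _ ≤ traceNorm (Φ (Y + s • F)) + s * traceNorm (Φ F) := by
        refine (traceNorm_add_le _ _).trans_eq ?_
        rw [traceNorm_smul, norm_neg, Complex.norm_of_nonneg hs0]
    _ ≤ 2 * ε := by
        have hΦZ := hΦ _ σ hZ hσ hZσ
        have hΦF := mul_le_mul hs1 (hΦ F σ hF hσ hF2) (traceNorm_nonneg _) zero_le_one
        linarith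

theorem IsBoundedOnDominated.traceNorm_le [Nonempty N] (hε : 0 ≤ ε)
    (hΦ : IsBoundedOnDominated (2 * t) ε Φ) (ht : (Fintype.card N : ℝ)⁻¹ ≤ t)
    {C : Matrix m m ℂ} (hC : 0 ≤ C) (hCtrace : C.trace.re ≤ 1) {s : ℝ} (hs : 0 < s)
    (hYC : Y ≤ (s * t) • (C ⊗ₖ 𝟙[N])) (htrace : Y.trace.re ≤ s) :
    traceNorm (Φ Y) ≤ 2 * s * ε := by
  have ht0 : 0 ≤ t := le_trans (by positivity) ht
  rcases eq_or_ne C 0 with rfl | hC0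
  · rw [Matrix.zero_kronecker, smul_zero] at hYC
    rw [le_antisymm hYC hY, map_zero, traceNorm_zero]
    positivity
  obtain ⟨σ, hσ, hCσ⟩ := exists_isState_ge hC hC0 hCtrace
  have hscaled : s⁻¹ • Y ≤ t • (σ ⊗ₖ 𝟙[N]) :=
    calc s⁻¹ • Y ≤ s⁻¹ • (s * t) • (C ⊗ₖ 𝟙[N]) :=
          smul_le_smul_of_nonneg_left hYC (inv_pos.2 hs).le
      _ = t • (C ⊗ₖ 𝟙[N]) := by rw [mul_smul, inv_smul_smul₀ hs.ne']
      _ ≤ t • (σ ⊗ₖ 𝟙[N]) := smul_le_smul_of_nonneg_left (kronecker_one_mono hCσ) ht0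
  have hscaledTrace : (s⁻¹ • Y).trace.re ≤ 1 := by
    rw [Matrix.trace_smul, Complex.smul_re, smul_eq_mul]
    exact inv_mul_le_one_of_le₀ htrace hs.le
  calc traceNorm (Φ Y) = s * traceNorm (Φ (s⁻¹ • Y)) := by
        rw [← Complex.coe_smul, map_smul, traceNorm_smul, Complex.norm_of_nonneg (inv_pos.2 hs).le,
          mul_inv_cancel_left₀ hs.ne']
    _ ≤ s * (2 * ε) := mul_le_mul_of_nonneg_left (hΦ.traceNorm_le_of_re_trace_le_one
        (smul_nonneg (inv_pos.2 hs).le hY) ht hσ hscaled hscaledTrace) hs.le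
    _ = 2 * s * ε := by ring

omit hY

theorem IsBoundedOnDominated.traceNorm_mul_conjTranspose_le [Nonempty N] (hε : 0 ≤ ε)
    (hΦ : IsBoundedOnDominated (2 * t) ε Φ) (ht : (Fintype.card N : ℝ)⁻¹ ≤ t) {c : ℝ} (hc : 0 < c)
    {a b : Matrix (m × N) (m × N) ℂ} {S T : Matrix m m ℂ} (hS : 0 ≤ S) (hT : 0 ≤ T)
    (hStrace : S.trace.re ≤ 1) (hTtrace : T.trace.re ≤ 1)
    (ha : a * aᴴ ≤ (c * t) • (S ⊗ₖ 𝟙[N])) (hb : b * bᴴ ≤ (c * t) • (T ⊗ₖ 𝟙[N]))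
    (hatrace : (a * aᴴ).trace.re ≤ c) (hbtrace : (b * bᴴ).trace.re ≤ c) :
    traceNorm (Φ (a * bᴴ)) ≤ 8 * c * ε := by
  refine traceNorm_map_mul_conjTranspose_le a b Φ fun z hz => ?_
  have hle := add_smul_mul_conjTranspose_le a b hz
  have hdom : (a + z • b) * (a + z • b)ᴴ ≤ (4 * c * t) • (((2 : ℝ)⁻¹ • (S + T)) ⊗ₖ 𝟙[N]) :=
    calc _ ≤ (2 : ℝ) • (a * aᴴ + b * bᴴ) := hle
      _ ≤ (2 : ℝ) • ((c * t) • (S ⊗ₖ 𝟙[N]) + (c * t) • (T ⊗ₖ 𝟙[N])) :=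
          smul_le_smul_of_nonneg_left (add_le_add ha hb) zero_le_two
      _ = (4 * c * t) • (((2 : ℝ)⁻¹ • (S + T)) ⊗ₖ 𝟙[N]) := by
          rw [Matrix.smul_kronecker, Matrix.add_kronecker]
          module
  have htrace : ((a + z • b) * (a + z • b)ᴴ).trace.re ≤ 4 * c := by
    refine (re_trace_mono hle).trans ?_
    rw [Matrix.trace_smul, Matrix.trace_add, Complex.smul_re, Complex.add_re, smul_eq_mul]
    linarith
  have hSTtrace : ((2 : ℝ)⁻¹ • (S + T)).trace.re ≤ 1 := by
    rw [Matrix.trace_smul, Matrix.trace_add, Complex.smul_re, Complex.add_re, smul_eq_mul]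
    linarith
  refine (hΦ.traceNorm_le (nonneg_mul_conjTranspose _) hε ht
    (smul_nonneg (by norm_num) (add_nonneg hS hT)) hSTtrace (by positivity) hdom htrace).trans_eq ?_
  ring

end Domination

section CbNorm

variable {q : ℕ} {N M : Type*} [Fintype N] [DecidableEq N] [Fintype M] [DecidableEq M]
  {u : (N → ℂ) →ₗ[ℂ] (M → ℂ)} {ε : ℝ}

theorem IsBoundedOnMinEntropy.isBoundedOnDominated_blockMap {κ : ℝ}
    (hu : IsBoundedOnMinEntropy κ ε u) :
    IsBoundedOnDominated (2 ^ (-κ)) ε (blockMap (q := q) u) := fun Y σ hY hσ hYσ => by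
  have hstate : IsCQState (diagPart Y) :=
    ⟨Matrix.nonneg_iff_posSemidef.1 (embed_diagPart_nonneg hY.nonneg),
      (trace_embed_diagPart Y).trans hY.2⟩
  have hle : embed (diagPart Y) ≤ (2 : ℝ) ^ (-κ) • (σ ⊗ₖ 𝟙[N]) := by
    rw [← Matrix.smul_kronecker] at hYσ ⊢
    exact (embed_diagPart_mono hYσ).trans_eq (embed_diagPart_kronecker_one _)
  exact hu q _ hstate (le_condMinEntropy hstate hσ hle)

theorem IsBoundedOnDominated.ellOne_map_le [Nonempty N] (hε : 0 ≤ ε) {K : ℝ} (hK : 0 < K)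
    (hKN : K ≤ Fintype.card N) (hu : IsBoundedOnDominated (2 * K⁻¹) ε (blockMap (q := q) u))
    {x : Matrix (Fin q) (Fin q) (N → ℂ)} (hx : capCap N K q x ≤ 1) :
    ellOne M q (x.map u) ≤ ENNReal.ofReal (8 * ε) := by
  refine iSup₂_le fun A B => iSup₂_le fun hA hB => ENNReal.ofReal_le_ofReal ?_
  refine (le_iff_forall_one_lt_le_mul₀ (by positivity)).2 fun c hc => ?_
  have hc0 : 0 < c := one_pos.trans hc
  obtain ⟨a, b, hab, ha, hb⟩ := exists_factorization hK hx hc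
  have hAtrace : (A * Aᴴ).trace.re ≤ 1 := by
    rw [Matrix.trace_mul_comm, ← hsNorm_sq]
    exact pow_le_one₀ (hsNorm_nonneg A) hA
  have hBtrace : (Bᴴ * Bᴴᴴ).trace.re ≤ 1 := by
    rw [Matrix.conjTranspose_conjTranspose, ← hsNorm_sq]
    exact pow_le_one₀ (hsNorm_nonneg B) hB
  have hmap : (A ⊗ₖ 𝟙[M]) * embed (x.map u) * (B ⊗ₖ 𝟙[M]) =
      blockMap u ((A ⊗ₖ 𝟙[N]) * a * ((Bᴴ ⊗ₖ 𝟙[N]) * b)ᴴ) := by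
    rw [← blockMap_embed, ← blockMap_kronecker_one_mul_mul, hab, Matrix.conjTranspose_mul,
      conjTranspose_kronecker_one, Matrix.conjTranspose_conjTranspose]
    simp only [mul_assoc]
  rw [hmap, mul_right_comm]
  exact hu.traceNorm_mul_conjTranspose_le hε (inv_anti₀ hK hKN) hc0
    (nonneg_mul_conjTranspose A) (nonneg_mul_conjTranspose Bᴴ) hAtrace hBtrace
    (kronecker_one_mul_factor_le hK hc0.le ha A) (kronecker_one_mul_factor_le hK hc0.le hb Bᴴ)
    ((re_trace_kronecker_one_mul_factor_le hK hc0.le ha A).trans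
      (mul_le_of_le_one_right hc0.le hAtrace))
    ((re_trace_kronecker_one_mul_factor_le hK hc0.le hb Bᴴ).trans
      (mul_le_of_le_one_right hc0.le hBtrace))

theorem cbNorm_le_of_isBoundedOnMinEntropy (hε : 0 ≤ ε) {k : ℝ}
    (hkN : (2 : ℝ) ^ k ≤ Fintype.card N) (hu : IsBoundedOnMinEntropy (k - 1) ε u) :
    cbNorm (capCap N (2 ^ k)) (ellOne M) u ≤ ENNReal.ofReal (8 * ε) := by
  have hK : (0 : ℝ) < 2 ^ k := by positivity
  have : Nonempty N := Fintype.card_pos_iff.1 (Nat.cast_pos.1 (hK.trans_le hkN))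
  have hpow : (2 : ℝ) ^ (-(k - 1)) = 2 * (2 ^ k)⁻¹ := by
    rw [neg_sub, Real.rpow_sub two_pos, Real.rpow_one, div_eq_mul_inv]
  refine iSup_le fun q => iSup₂_le fun x hx => ?_
  have hdom := hu.isBoundedOnDominated_blockMap (q := q)
  rw [hpow] at hdom
  exact hdom.ellOne_map_le hε hK hkN hx

end CbNorm

theorem two_rpow_le_card_bits {n : ℕ} {k : ℝ} (hk : k ≤ n) :
    (2 : ℝ) ^ k ≤ Fintype.card (Fin n → Bool) := by
  rw [Fintype.card_fun, Fintype.card_bool, Fintype.card_fin, Nat.cast_pow, Nat.cast_ofNat,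
    ← Real.rpow_natCast]
  exact Real.rpow_le_rpow_of_exponent_le one_le_two hk

end QuantumExtractor

end

theorem theorem2_general {N M : Type*} [Fintype N] [DecidableEq N] [Fintype M] [DecidableEq M]
    (u : (N → ℂ) →ₗ[ℂ] (M → ℂ)) (k ε : ℝ) (hε : 0 ≤ ε) :
    (QuantumExtractor.cbNorm (QuantumExtractor.capCap N ((2 : ℝ) ^ k)) (QuantumExtractor.ellOne M)
          u ≤ ENNReal.ofReal ε →
        QuantumExtractor.IsBoundedOnMinEntropy k (2 * ε) u) ∧
      ((2 : ℝ) ^ k ≤ Fintype.card N → QuantumExtractor.IsBoundedOnMinEntropy (k - 1) ε u →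
        QuantumExtractor.cbNorm (QuantumExtractor.capCap N ((2 : ℝ) ^ k))
          (QuantumExtractor.ellOne M) u ≤ ENNReal.ofReal (8 * ε)) :=
  ⟨QuantumExtractor.isBoundedOnMinEntropy_of_cbNorm_le hε,
    QuantumExtractor.cbNorm_le_of_isBoundedOnMinEntropy hε⟩

theorem theorem2 (n m d : ℕ) (f : (Fin d → Bool) → (Fin n → Bool) → (Fin m → Bool))
    (k ε : ℝ) (hε : 0 ≤ ε) :
    (QuantumExtractor.cbNorm (QuantumExtractor.capCap (Fin n → Bool) ((2 : ℝ) ^ k))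
          (QuantumExtractor.ellOne (Fin m → Bool)) (QuantumExtractor.Delta f) ≤ ENNReal.ofReal ε →
        QuantumExtractor.IsQuantumProof k (2 * ε) f) ∧
      (k ≤ n → QuantumExtractor.IsQuantumProof (k - 1) ε f →
        QuantumExtractor.cbNorm (QuantumExtractor.capCap (Fin n → Bool) ((2 : ℝ) ^ k))
          (QuantumExtractor.ellOne (Fin m → Bool)) (QuantumExtractor.Delta f) ≤
            ENNReal.ofReal (8 * ε)) := by
  simp only [QuantumExtractor.isQuantumProof_iff]
  exact (theorem2_general (QuantumExtractor.Delta f) k ε hε).imp_right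
    fun h hk => h (QuantumExtractor.two_rpow_le_card_bits hk)
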